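/- Let $M$ be an $n$-dimensional smooth manifold and let $\pi_M\colon L(M)\to M$ be its bundle of linear frames: a point of $L(M)$ over $x$ is a linear isomorphism $u\colon\mathbb{R}^n\to T_xM$, and $GL(n;\mathbb{R})$ acts on the right by $ua=u\circ a$. Let $\omega$ be a linear connection on $M$, i.e. a smooth principal connection form on $L(M)$ with values in $\mathfrak{gl}(n;\mathbb{R})$. For $\xi\in\mathbb{R}^n$ let $\Phi_\xi\colon L(M)\to TM$ be the map $\Phi_\xi(u)=u\xi$, and let $B(\xi)$ be the standard horizontal vector field of $\omega$: $B(\xi)_u$ is the unique vector $X\in T_uL(M)$ with $\omega(X)=0$ and $T_u\pi_M(X)=u\xi$. Let $\nabla$ be the affine connection on $M$ corresponding to $\omega$: $\nabla_XY(x)=u\big(X^h f_Y\big)$ for every frame $u$ at $x$, where $X^h\in T_uL(M)$ is the horizontal vector with $T_u\pi_M(X^h)=X$ and $f_Y(w)=w^{-1}(Y(\pi_M(w)))$ for $w\in L(M)$. Then the vectors $B(\xi)_u$ and a connection $\nabla$ as above exist, and there is exactly one map $Z$ assigning to each $v\in TM$ a vector $Z(v)\in T_vTM$ such that $$Z(v)=T_u\Phi_\xi(B(\xi)_u)\qquad\text{for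 all } u\in L(M),\ \xi\in\mathbb{R}^n \text{ with } u\xi=v .$$ This $Z$ is a second-order vector field on $TM$: it is a smooth vector field and $T\tau_M(Z(v))=v$ for all $v\in TM$, where $\tau_M\colon TM\to M$ is the projection. For every chart $(x^i)$ of $M$, in the canonical coordinates $(x^i,v^i)$ that it induces on $TM$, $$Z=v^i\frac{\partial}{\partial x^i}-\Gamma^i_{jk}v^jv^k\frac{\partial}{\partial v^i},$$ where the $\Gamma^i_{jk}$ are the Christoffel symbols of $\nabla$, $\nabla_{\partial/\partial x^j}\frac{\partial}{\partial x^k}=\Gamma^i_{jk}\frac{\partial}{\partial x^i}$, and repeated indices are summed. -/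

import Mathlib

open Bundle Set TopologicalSpace
open scoped Manifold ContDiff

noncomputable section

/-- The model space `ℝⁿ`. -/
abbrev Rn (n : ℕ) : Type := EuclideanSpace ℝ (Fin n)

/-- The Lie algebra `𝔤𝔩(n; ℝ)`, as the endomorphisms of `ℝⁿ`. -/
abbrev gl (n : ℕ) : Type := Rn n →L[ℝ] Rn n

/-- The Lie group `GL(n; ℝ)`, as the group of invertible endomorphisms of `ℝⁿ`. -/
abbrev GLn (n : ℕ) : Type := (gl n)ˣ

/-! ### The bundle of linear frames -/

/-- The total space of the smooth vector bundle `Hom(ℝⁿ, TM)` over `M`, whose fibre at `x` is the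
space of all linear maps `ℝⁿ → T_x M`. -/
abbrev HomBundle (n : ℕ) (M : Type*) [TopologicalSpace M] [ChartedSpace (Rn n) M] : Type _ :=
  TotalSpace (Rn n →L[ℝ] Rn n) (fun x : M => Trivial M (Rn n) x →L[ℝ] TangentSpace (𝓡 n) x)

/-- The model with corners of `L(M)` (an open subset of `Hom(ℝⁿ, TM)`). -/
abbrev frameModel (n : ℕ) :
    ModelWithCorners ℝ (Rn n × gl n) (ModelProd (Rn n) (gl n)) :=
  (𝓡 n).prod 𝓘(ℝ, gl n)

section Frames

variable (n : ℕ) (M : Type*) [TopologicalSpace M] [ChartedSpace (Rn n) M]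

theorem isOpen_setOf_isInvertible_hom [IsManifold (𝓡 n) ∞ M] :
    IsOpen {u : HomBundle n M | ContinuousLinearMap.IsInvertible u.2} := by
  rw [isOpen_iff_mem_nhds]
  intro u₀ hu₀
  let e := trivializationAt (Rn n →L[ℝ] Rn n)
    (fun x : M => Trivial M (Rn n) x →L[ℝ] TangentSpace (𝓡 n) x) u₀.1
  have key : ∀ u ∈ e.source, ((e u).2.IsInvertible ↔ ContinuousLinearMap.IsInvertible u.2) := by
    intro u hu
    have h1 : u.1 ∈ (trivializationAt (Rn n) (Trivial M (Rn n)) u₀.1).baseSet := hu.1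
    have h2 : u.1 ∈ (trivializationAt (Rn n) (TangentSpace (𝓡 n) : M → Type) u₀.1).baseSet := hu.2
    have h3 : (e u).2 = ContinuousLinearMap.inCoordinates (Rn n) (Trivial M (Rn n)) (Rn n)
        (TangentSpace (𝓡 n) : M → Type) u₀.1 u.1 u₀.1 u.1 u.2 := rfl
    rw [h3, ContinuousLinearMap.inCoordinates_eq h1 h2, ContinuousLinearMap.isInvertible_equiv_comp,
      ContinuousLinearMap.isInvertible_comp_equiv]
  have hmem : u₀ ∈ e.source := FiberBundle.mem_trivializationAt_proj_source
  have hopen : IsOpen {A : Rn n →L[ℝ] Rn n | A.IsInvertible} :=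
    ContinuousLinearEquiv.isOpen (𝕜 := ℝ) (E := Rn n) (F := Rn n)
  have hc : ContinuousAt e u₀ := e.continuousAt hmem
  have h4 : ∀ᶠ u in nhds u₀, (e u).2.IsInvertible :=
    hc.snd.eventually (hopen.mem_nhds ((key u₀ hmem).2 hu₀))
  filter_upwards [h4, e.open_source.mem_nhds hmem] with u hu hus
  exact (key u hus).1 hu

/-- The set of linear frames `u : ℝⁿ ≃ T_x M`, as an open subset of `Hom(ℝⁿ, TM)`. -/
def frameOpens [IsManifold (𝓡 n) ∞ M] : Opens (HomBundle n M) :=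
  ⟨{u | ContinuousLinearMap.IsInvertible u.2}, isOpen_setOf_isInvertible_hom n M⟩

/-- The total space `L(M)` of the bundle of linear frames: a point is a pair `(x, u)` of a point
`x : M` and a linear isomorphism `u : ℝⁿ → T_x M`. -/
abbrev FrameBundle [IsManifold (𝓡 n) ∞ M] : Type _ := frameOpens n M

instance HomBundle.isManifold [IsManifold (𝓡 n) ∞ M] :
    IsManifold (frameModel n) ∞ (HomBundle n M) :=
  Bundle.TotalSpace.isManifold (n := ∞) (gl n) _

instance FrameBundle.isManifold [IsManifold (𝓡 n) ∞ M] :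
    IsManifold (frameModel n) ∞ (FrameBundle n M) :=
  inferInstance

instance FrameBundle.isManifold_one [IsManifold (𝓡 n) ∞ M] :
    IsManifold (frameModel n) 1 (FrameBundle n M) :=
  IsManifold.of_le (n := ∞) (by simp)

end Frames

namespace FrameBundle

variable {n : ℕ} {M : Type*} [TopologicalSpace M] [ChartedSpace (Rn n) M] [IsManifold (𝓡 n) ∞ M]

/-- The canonical projection `π_M : L(M) → M`. -/
def proj (u : FrameBundle n M) : M := u.1.1

/-- The frame `u`, as a linear map `ℝⁿ → T_{π(u)} M`. -/
def map (u : FrameBundle n M) : Rn n →L[ℝ] TangentSpace (𝓡 n) u.proj := u.1.2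

/-- The right action `Φ_a(u) = ua = u ∘ a` of `GL(n; ℝ)` on `L(M)`. -/
def act (u : FrameBundle n M) (a : GLn n) : FrameBundle n M :=
  ⟨⟨u.1.1, ContinuousLinearMap.comp u.map (a : gl n)⟩,
    ContinuousLinearMap.IsInvertible.comp u.2 ⟨ContinuousLinearEquiv.unitsEquiv ℝ (Rn n) a, rfl⟩⟩

/-- The infinitesimal generator `A_{L(M)}` of `A ∈ 𝔤𝔩(n; ℝ)`: the derivative at the identity of
`a ↦ ua`, in the direction `A`. -/
def generator (A : gl n) (u : FrameBundle n M) : TangentSpace (frameModel n) u :=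
  mfderiv 𝓘(ℝ, gl n) (frameModel n) (fun a : GLn n => u.act a) 1 A

/-- The association map `Φ_ξ : L(M) → TM`, `u ↦ uξ`. -/
def assoc (ξ : Rn n) (u : FrameBundle n M) : TangentBundle (𝓡 n) M := ⟨u.proj, u.map ξ⟩

/-- The function `f_Y : L(M) → ℝⁿ`, `u ↦ u⁻¹(Y(π(u)))`, associated with a vector field `Y`. -/
def vectorFun (Y : Π x : M, TangentSpace (𝓡 n) x) (u : FrameBundle n M) : Rn n :=
  u.map.inverse (Y u.proj)

end FrameBundle

/-! ### Linear connections -/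

/-- A linear connection on `M`: a smooth principal connection form `ω` on `L(M)`. -/
structure LinearConnection (n : ℕ) (M : Type*) [TopologicalSpace M] [ChartedSpace (Rn n) M]
    [IsManifold (𝓡 n) ∞ M] where
  /-- The connection form, a one-form on `L(M)` with values in `𝔤𝔩(n; ℝ)`. -/
  form : Π u : FrameBundle n M, TangentSpace (frameModel n) u →L[ℝ] gl n
  smooth : ContMDiff (frameModel n).tangent 𝓘(ℝ, gl n) ∞
    (fun X : TangentBundle (frameModel n) (FrameBundle n M) => form X.1 X.2)
  /-- `ω(A_{L(M)}) = A`. -/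
  form_generator : ∀ (A : gl n) (u : FrameBundle n M), form u (u.generator A) = A
  /-- `Φ_a^* ω = Ad(a⁻¹) ω`. -/
  form_act : ∀ (a : GLn n) (u : FrameBundle n M) (X : TangentSpace (frameModel n) u),
    form (u.act a) (mfderiv (frameModel n) (frameModel n) (fun w : FrameBundle n M => w.act a) u X)
      = ((a⁻¹ : GLn n) : gl n) * form u X * (a : gl n)

namespace LinearConnection

variable {n : ℕ} {M : Type*} [TopologicalSpace M] [ChartedSpace (Rn n) M] [IsManifold (𝓡 n) ∞ M]

/-- `X` is a horizontal vector at `u` which projects to `uξ`. -/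
def IsStandardHorizontal (C : LinearConnection n M) (ξ : Rn n) (u : FrameBundle n M)
    (X : TangentSpace (frameModel n) u) : Prop :=
  C.form u X = 0 ∧
    mfderiv (frameModel n) (𝓡 n) (FrameBundle.proj : FrameBundle n M → M) u X = u.map ξ

/-- The standard horizontal vector field `B(ξ)`: `B(ξ)_u` is the (unique) horizontal vector at `u`
which projects to `uξ`. -/
def standardHorizontal (C : LinearConnection n M) (ξ : Rn n) (u : FrameBundle n M) :
    TangentSpace (frameModel n) u :=
  Classical.epsilon (C.IsStandardHorizontal ξ u)

/-- The defining property of the map `Z`: `Z(v) = T_uΦ_ξ(B(ξ)_u)` for all `u ∈ L(M)` and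
`ξ ∈ ℝⁿ` with `uξ = v`. -/
def IsGeodesicSpray (C : LinearConnection n M)
    (Z : Π v : TangentBundle (𝓡 n) M, TangentSpace (𝓡 n).tangent v) : Prop :=
  ∀ (u : FrameBundle n M) (ξ : Rn n),
    Z (FrameBundle.assoc ξ u) =
      mfderiv (frameModel n) (𝓡 n).tangent (FrameBundle.assoc ξ : FrameBundle n M → _) u
        (C.standardHorizontal ξ u)

/-- The affine connection `∇` corresponds to the linear connection `C`:
`∇_X Y (x) = u(X^h f_Y)` for every frame `u` at `x` and every horizontal `X^h ∈ T_u L(M)` which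
projects to `X`. -/
def Corresponds (C : LinearConnection n M)
    (cov : CovariantDerivative (𝓡 n) (Rn n) (TangentSpace (𝓡 n) : M → Type)) : Prop :=
  ∀ (u : FrameBundle n M) (X : TangentSpace (frameModel n) u), C.form u X = 0 →
    ∀ Y : Π x : M, TangentSpace (𝓡 n) x,
      MDifferentiableAt (𝓡 n) (𝓡 n).tangent
        (fun x => (⟨x, Y x⟩ : TangentBundle (𝓡 n) M)) u.proj →
      cov Y u.proj (mfderiv (frameModel n) (𝓡 n) (FrameBundle.proj : FrameBundle n M → M) u X) =
        u.map (mfderiv (frameModel n) 𝓘(ℝ, Rn n) (FrameBundle.vectorFun Y) u X)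

end LinearConnection

/-! ### Coordinates -/

section Coordinates

variable {n : ℕ} {M : Type*} [TopologicalSpace M] [ChartedSpace (Rn n) M] [IsManifold (𝓡 n) ∞ M]

/-- The coordinate vector field `∂/∂x^i` of a chart `φ` of `M` (meaningful on `φ.source`). -/
def coordField (φ : OpenPartialHomeomorph M (Rn n)) (i : Fin n) (x : M) : TangentSpace (𝓡 n) x :=
  mfderiv 𝓘(ℝ, Rn n) (𝓡 n) φ.symm (φ x) (EuclideanSpace.single i 1)

/-- The fibre coordinates `(v^1, …, v^n)` of a tangent vector in a chart `φ`: the components of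
`v` with respect to the fields `∂/∂x^i`. -/
def fibreCoord (φ : OpenPartialHomeomorph M (Rn n)) {x : M} (v : TangentSpace (𝓡 n) x) : Rn n :=
  mfderiv (𝓡 n) 𝓘(ℝ, Rn n) φ x v

/-- The Christoffel symbols of an affine connection in a chart `φ`:
`∇_{∂_j} ∂_k = Γ^i_{jk} ∂_i`. -/
def christoffel (cov : CovariantDerivative (𝓡 n) (Rn n) (TangentSpace (𝓡 n) : M → Type))
    (φ : OpenPartialHomeomorph M (Rn n)) (i j k : Fin n) (x : M) : ℝ :=
  fibreCoord φ (cov (coordField φ k) x (coordField φ j x)) i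

/-- The inverse of the canonical coordinate system `(x^i, v^i)` of `TM` induced by a chart `φ` of
`M`: it sends `(y, w)` to the vector `Σ w^i ∂/∂x^i` at the point with coordinates `y`. -/
def tangentCoordSymm (φ : OpenPartialHomeomorph M (Rn n)) (p : Rn n × Rn n) :
    TangentBundle (𝓡 n) M :=
  ⟨φ.symm p.1, mfderiv 𝓘(ℝ, Rn n) (𝓡 n) φ.symm p.1 p.2⟩

/-- The coordinate vector field `∂/∂x^i` on `TM`, in the coordinates `(x^i, v^i)`. -/
def tangentCoordFieldX (φ : OpenPartialHomeomorph M (Rn n)) (i : Fin n)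
    (v : TangentBundle (𝓡 n) M) : TangentSpace (𝓡 n).tangent v :=
  mfderiv 𝓘(ℝ, Rn n × Rn n) (𝓡 n).tangent (tangentCoordSymm φ : _ → TangentBundle (𝓡 n) M)
    (φ v.1, fibreCoord φ v.2) (EuclideanSpace.single i 1, 0)

/-- The coordinate vector field `∂/∂v^i` on `TM`, in the coordinates `(x^i, v^i)`. -/
def tangentCoordFieldV (φ : OpenPartialHomeomorph M (Rn n)) (i : Fin n)
    (v : TangentBundle (𝓡 n) M) : TangentSpace (𝓡 n).tangent v :=
  mfderiv 𝓘(ℝ, Rn n × Rn n) (𝓡 n).tangent (tangentCoordSymm φ : _ → TangentBundle (𝓡 n) M)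
    (φ v.1, fibreCoord φ v.2) (0, EuclideanSpace.single i 1)

/-- A second-order vector field on `TM`: a smooth vector field `Z` on `TM` with
`Tτ_M(Z(v)) = v`. -/
structure IsSecondOrderVectorField
    (Z : Π v : TangentBundle (𝓡 n) M, TangentSpace (𝓡 n).tangent v) : Prop where
  smooth : ContMDiff (𝓡 n).tangent (𝓡 n).tangent.tangent ∞
    (fun v => (⟨v, Z v⟩ : TangentBundle (𝓡 n).tangent (TangentBundle (𝓡 n) M)))
  mfderiv_proj : ∀ v : TangentBundle (𝓡 n) M,
    mfderiv (𝓡 n).tangent (𝓡 n)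
      (TotalSpace.proj : TangentBundle (𝓡 n) M → M) v (Z v) = v.2

end Coordinates

end

/-! Write `R_a` for the right action and `π` for the projection of `L(M)`. Generators are vertical
and `ω` takes every value on them, so `(ω, Tπ)` maps `T_u L(M)` onto `𝔤𝔩(n) × T_x M`; the dimensions
agree, so it is bijective (`splitting_bijective`). Hence `B(ξ)_u` exists and is unique.

If `uξ = v`, the other representations of `v` are `(ua, a⁻¹ξ)`. Equivariance of `ω` gives
`TR_a(B(aξ)_u) = B(ξ)_{ua}`, and `Φ_ξ ∘ R_a = Φ_{aξ}`, so `TΦ_ξ(B(ξ)_u)` depends on `uξ` alone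
(`mfderiv_assoc_act`). Likewise `f_Y ∘ R_a = a⁻¹ f_Y` makes `u(X^h f_Y)` independent of the frame,
which yields `∇`; its Leibniz rule is that of `f_{gY} = (g ∘ π) f_Y`.

For the coordinate formula let `s` be the local section of `L(M)` given by the frame `(∂_1, …, ∂_n)`
of a chart, and `Γ = s^*ω` (`localForm`). Then `B(w)` at `s(y)` is `Ts(w)` minus the generator of
`Γ(w)`. Now `Φ_w` takes `Ts(w)` to `(w, 0)` and the generator of `A` to `(0, Aw)`, whence `Z = (w,
-Γ(w)w)`. On the other side `f_{∂_k} ∘ s` is the constant `e_k` and the generator of `A`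
differentiates `f_Y` to `-A f_Y`, so `∇_{∂_j} ∂_k = s(Γ(e_j)e_k)`: the entries of `Γ` are the
Christoffel symbols. Smoothness of `Z` follows from the same formula, since `Γ` is smooth. -/

/-! ### Smooth maps into and out of the frame bundle -/

section FrameBundleSmoothness

variable {n : ℕ} {M : Type*} [TopologicalSpace M] [ChartedSpace (Rn n) M] [IsManifold (𝓡 n) ∞ M]

namespace FrameBundle

/-- The matrix of a frame in the preferred trivialization of `TM` at `x₀`. -/
noncomputable def coord (x₀ : M) (u : FrameBundle n M) : gl n :=
  ((trivializationAt (Rn n) (TangentSpace (𝓡 n) : M → Type) x₀).continuousLinearMapAt ℝ u.proj).comp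
    u.map

theorem inCoordinates_trivial_eq (x₀ x : M) (u : Trivial M (Rn n) x →L[ℝ] TangentSpace (𝓡 n) x) :
    ContinuousLinearMap.inCoordinates (Rn n) (Trivial M (Rn n)) (Rn n)
      (TangentSpace (𝓡 n) : M → Type) x₀ x x₀ x u =
    ((trivializationAt (Rn n) (TangentSpace (𝓡 n) : M → Type) x₀).continuousLinearMapAt ℝ x).comp
      u := by
  ext v : 1
  simp [ContinuousLinearMap.inCoordinates]

variable {EN : Type*} [NormedAddCommGroup EN] [NormedSpace ℝ EN] {HN : Type*} [TopologicalSpace HN]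
  {IN : ModelWithCorners ℝ EN HN} {N : Type*} [TopologicalSpace N] [ChartedSpace HN N]

/-- `L(M)` is open in `Hom(ℝⁿ, TM)`, and the source bundle is trivial, so a trivialization of `TM`
alone turns frames into matrices. The smoothness of the actions and of chart frames is reduced to
matrices through this criterion. -/
theorem contMDiffAt_iff {f : N → FrameBundle n M} {p : N} :
    ContMDiffAt IN (frameModel n) ∞ f p ↔
      ContMDiffAt IN (𝓡 n) ∞ (fun q => (f q).proj) p ∧
        ContMDiffAt IN 𝓘(ℝ, gl n) ∞ (fun q => (f q).coord (f p).proj) p := by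
  rw [← ContMDiffAt.subtypeVal_comp_iff, contMDiffAt_hom_bundle]
  simp only [inCoordinates_trivial_eq]
  rfl

theorem contMDiff_proj : ContMDiff (frameModel n) (𝓡 n) ∞ (proj : FrameBundle n M → M) :=
  fun _ => (contMDiffAt_iff.1 contMDiffAt_id).1

theorem contMDiffAt_coord (u : FrameBundle n M) :
    ContMDiffAt (frameModel n) 𝓘(ℝ, gl n) ∞ (coord u.proj) u :=
  (contMDiffAt_iff.1 contMDiffAt_id).2

@[simp] theorem proj_act (u : FrameBundle n M) (a : GLn n) : (u.act a).proj = u.proj := rfl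

@[simp] theorem map_act (u : FrameBundle n M) (a : GLn n) (ξ : Rn n) :
    (u.act a).map ξ = u.map ((a : gl n) ξ) := rfl

theorem contMDiff_act (a : GLn n) :
    ContMDiff (frameModel n) (frameModel n) ∞ (fun u : FrameBundle n M => u.act a) := fun u =>
  contMDiffAt_iff.2 ⟨contMDiff_proj u, (contMDiffAt_coord u).clm_comp contMDiffAt_const⟩

theorem contMDiff_act_right (u : FrameBundle n M) :
    ContMDiff 𝓘(ℝ, gl n) (frameModel n) ∞ (fun a : GLn n => u.act a) := fun a =>
  contMDiffAt_iff.2 ⟨contMDiffAt_const,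
    (contMDiffAt_const (c := u.coord u.proj)).clm_comp (Units.contMDiff_val a)⟩

theorem eventually_proj_mem_baseSet (u : FrameBundle n M) : ∀ᶠ w in nhds u,
    w.proj ∈ (trivializationAt (Rn n) (TangentSpace (𝓡 n) : M → Type) u.proj).baseSet :=
  (contMDiff_proj u).continuousAt.preimage_mem_nhds
    ((trivializationAt (Rn n) (TangentSpace (𝓡 n) : M → Type) u.proj).open_baseSet.mem_nhds
      (FiberBundle.mem_baseSet_trivializationAt' _))

theorem contMDiff_assoc (ξ : Rn n) :
    ContMDiff (frameModel n) (𝓡 n).tangent ∞ (assoc ξ : FrameBundle n M → _) := fun u => by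
  refine contMDiffAt_totalSpace.2 ⟨contMDiff_proj u, ?_⟩
  refine ((contMDiffAt_coord u).clm_apply (contMDiffAt_const (c := ξ))).congr_of_eventuallyEq ?_
  filter_upwards [eventually_proj_mem_baseSet u] with w hw
  simp only [coord, assoc, ContinuousLinearMap.comp_apply]
  exact ((trivializationAt (Rn n) (TangentSpace (𝓡 n) : M → Type)
    u.proj).continuousLinearMapAt_apply_of_mem ℝ hw _).symm

end FrameBundle

end FrameBundleSmoothness

/-! ### The functions `f_Y` and the frame of a chart -/

section ChartFrame

variable {n : ℕ} {M : Type*} [TopologicalSpace M] [ChartedSpace (Rn n) M] [IsManifold (𝓡 n) ∞ M]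

namespace FrameBundle

theorem map_isInvertible (u : FrameBundle n M) : u.map.IsInvertible := u.2

theorem map_vectorFun (Y : Π x : M, TangentSpace (𝓡 n) x) (u : FrameBundle n M) :
    u.map (vectorFun Y u) = Y u.proj :=
  u.map_isInvertible.self_apply_inverse _

theorem vectorFun_eq_of_map_eq {Y : Π x : M, TangentSpace (𝓡 n) x} {u : FrameBundle n M} {ξ : Rn n}
    (h : u.map ξ = Y u.proj) : vectorFun Y u = ξ := by
  rw [vectorFun, ← h, u.map_isInvertible.inverse_apply_self]

theorem vectorFun_act (Y : Π x : M, TangentSpace (𝓡 n) x) (u : FrameBundle n M) (a : GLn n) :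
    vectorFun Y (u.act a) = ((a⁻¹ : GLn n) : gl n) (vectorFun Y u) := by
  apply vectorFun_eq_of_map_eq
  rw [map_act, ← mul_apply_eq_comp, a.mul_inv, one_apply_eq_self,
    map_vectorFun, proj_act]

theorem coord_isInvertible {x₀ : M} {u : FrameBundle n M}
    (h : u.proj ∈ (trivializationAt (Rn n) (TangentSpace (𝓡 n) : M → Type) x₀).baseSet) :
    (u.coord x₀).IsInvertible := by
  refine ContinuousLinearMap.IsInvertible.comp ⟨(trivializationAt (Rn n)
    (TangentSpace (𝓡 n) : M → Type) x₀).continuousLinearEquivAt ℝ u.proj h, ?_⟩ u.map_isInvertible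
  ext v : 1
  exact (Trivialization.continuousLinearMapAt_apply_of_mem ℝ _ h v).symm

/-- In a trivialization `f_Y` is the inverse of the frame matrix applied to the components of `Y`,
and inversion is smooth at invertible maps. -/
theorem mdifferentiableAt_vectorFun {Y : Π x : M, TangentSpace (𝓡 n) x} {u : FrameBundle n M}
    (hY : MDifferentiableAt (𝓡 n) (𝓡 n).tangent
      (fun x => (⟨x, Y x⟩ : TangentBundle (𝓡 n) M)) u.proj) :
    MDifferentiableAt (frameModel n) 𝓘(ℝ, Rn n) (vectorFun Y) u := by
  have h1 : MDifferentiableAt (frameModel n) 𝓘(ℝ, Rn n) (fun w : FrameBundle n M =>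
      (trivializationAt (Rn n) (TangentSpace (𝓡 n) : M → Type) u.proj ⟨w.proj, Y w.proj⟩).2) u :=
    ((mdifferentiableAt_section _ _).1 hY).comp u ((contMDiff_proj u).mdifferentiableAt (by simp))
  obtain ⟨e, he⟩ := coord_isInvertible (u := u) (FiberBundle.mem_baseSet_trivializationAt' _)
  have h2 : ContDiffAt ℝ ∞ ContinuousLinearMap.inverse (u.coord u.proj) := by
    rw [← he]; exact contDiffAt_map_inverse e
  have h3 : MDifferentiableAt (frameModel n) 𝓘(ℝ, gl n) (fun w : FrameBundle n M =>
      (w.coord u.proj).inverse) u :=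
    (h2.contMDiffAt.comp u (contMDiffAt_coord u)).mdifferentiableAt (by simp)
  refine (h3.clm_apply h1).congr_of_eventuallyEq ?_
  filter_upwards [eventually_proj_mem_baseSet u] with w hw
  rw [← Trivialization.continuousLinearMapAt_apply_of_mem ℝ _ hw, ← map_vectorFun Y w]
  exact ((coord_isInvertible hw).inverse_apply_self (vectorFun Y w)).symm

end FrameBundle

section

variable {φ : OpenPartialHomeomorph M (Rn n)}

omit [IsManifold (𝓡 n) ∞ M] in
theorem OpenPartialHomeomorph.mdifferentiable_of_mem_maximalAtlas
    (hφ : φ ∈ IsManifold.maximalAtlas (𝓡 n) ∞ M) : φ.MDifferentiable (𝓡 n) 𝓘(ℝ, Rn n) :=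
  ⟨(contMDiffOn_of_mem_maximalAtlas hφ).mdifferentiableOn (by simp),
    (contMDiffOn_symm_of_mem_maximalAtlas hφ).mdifferentiableOn (by simp)⟩

open Classical in
/-- The frame `(∂/∂x^1, …, ∂/∂x^n)` of a chart `φ`, at the point with coordinates `y`. Off the
target of `φ` it has a junk value. -/
noncomputable def chartFrame (φ : OpenPartialHomeomorph M (Rn n)) (y : Rn n) : FrameBundle n M :=
  if h : (mfderiv 𝓘(ℝ, Rn n) (𝓡 n) φ.symm y).IsInvertible then
    ⟨⟨φ.symm y, mfderiv 𝓘(ℝ, Rn n) (𝓡 n) φ.symm y⟩, h⟩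
  else ⟨⟨φ.symm y, ContinuousLinearMap.id ℝ (Rn n)⟩, ⟨ContinuousLinearEquiv.refl ℝ (Rn n), rfl⟩⟩

theorem chartFrame_eq (hφ : φ ∈ IsManifold.maximalAtlas (𝓡 n) ∞ M) {y : Rn n} (hy : y ∈ φ.target) :
    ∃ h, chartFrame φ y = ⟨⟨φ.symm y, mfderiv 𝓘(ℝ, Rn n) (𝓡 n) φ.symm y⟩, h⟩ := by
  have h : (mfderiv 𝓘(ℝ, Rn n) (𝓡 n) φ.symm y).IsInvertible :=
    ⟨(OpenPartialHomeomorph.mdifferentiable_of_mem_maximalAtlas hφ).symm.mfderiv hy, rfl⟩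
  exact ⟨h, dif_pos h⟩

@[simp] theorem proj_chartFrame (y : Rn n) : (chartFrame φ y).proj = φ.symm y := by
  unfold chartFrame; split_ifs <;> rfl

theorem assoc_chartFrame (hφ : φ ∈ IsManifold.maximalAtlas (𝓡 n) ∞ M) {y : Rn n}
    (hy : y ∈ φ.target) (w : Rn n) :
    FrameBundle.assoc w (chartFrame φ y) = tangentCoordSymm φ (y, w) := by
  obtain ⟨h, e⟩ := chartFrame_eq hφ hy
  rw [e]; rfl

theorem contMDiffAt_chartFrame (hφ : φ ∈ IsManifold.maximalAtlas (𝓡 n) ∞ M) {y : Rn n}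
    (hy : y ∈ φ.target) : ContMDiffAt 𝓘(ℝ, Rn n) (frameModel n) ∞ (chartFrame φ) y := by
  have h0 := contMDiffAt_symm_of_mem_maximalAtlas hφ hy
  refine FrameBundle.contMDiffAt_iff.2 ⟨by simpa using h0, ?_⟩
  refine (h0.mfderiv_const (m := ∞) le_rfl).congr_of_eventuallyEq ?_
  filter_upwards [φ.open_target.mem_nhds hy, h0.continuousAt.preimage_mem_nhds
    ((trivializationAt (Rn n) (TangentSpace (𝓡 n) : M → Type) (φ.symm y)).open_baseSet.mem_nhds
      (FiberBundle.mem_baseSet_trivializationAt' _))] with z hz hz'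
  obtain ⟨h, e⟩ := chartFrame_eq hφ hz
  rw [inTangentCoordinates_eq_mfderiv_comp (mem_univ z) hz', e, proj_chartFrame,
    ← TangentBundle.continuousLinearMapAt_trivializationAt hz']
  -- The chart of the source `ℝⁿ` is the identity, so `inTangentCoordinates` only trivializes the
  -- target, exactly as `coord` does.
  have h2 : mfderivWithin 𝓘(ℝ, Rn n) 𝓘(ℝ, Rn n) (extChartAt 𝓘(ℝ, Rn n) y).symm
      (range 𝓘(ℝ, Rn n)) (extChartAt 𝓘(ℝ, Rn n) y z) = ContinuousLinearMap.id ℝ _ := by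
    rw [extChartAt_model_space_eq_id]
    simp
    rfl
  erw [h2]
  rfl

theorem contMDiffAt_tangentCoordSymm (hφ : φ ∈ IsManifold.maximalAtlas (𝓡 n) ∞ M) {p : Rn n × Rn n}
    (hp : p.1 ∈ φ.target) :
    ContMDiffAt 𝓘(ℝ, Rn n × Rn n) (𝓡 n).tangent ∞
      (tangentCoordSymm φ : _ → TangentBundle (𝓡 n) M) p := by
  have hfst : ContMDiffAt 𝓘(ℝ, Rn n × Rn n) 𝓘(ℝ, Rn n) ∞ (Prod.fst : Rn n × Rn n → Rn n) p :=
    contDiffAt_fst.contMDiffAt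
  have hsnd : ContMDiffAt 𝓘(ℝ, Rn n × Rn n) 𝓘(ℝ, Rn n) ∞ (Prod.snd : Rn n × Rn n → Rn n) p :=
    contDiffAt_snd.contMDiffAt
  have h0 := contMDiffAt_symm_of_mem_maximalAtlas hφ hp
  have h1 := (FrameBundle.contMDiffAt_iff.1 (contMDiffAt_chartFrame hφ hp)).2
  refine contMDiffAt_totalSpace.2 ⟨h0.comp p hfst, ?_⟩
  refine ((h1.comp p hfst).clm_apply hsnd).congr_of_eventuallyEq ?_
  filter_upwards [hfst.continuousAt.preimage_mem_nhds (φ.open_target.mem_nhds hp),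
    (h0.comp p hfst).continuousAt.preimage_mem_nhds
    ((trivializationAt (Rn n) (TangentSpace (𝓡 n) : M → Type) (φ.symm p.1)).open_baseSet.mem_nhds
      (FiberBundle.mem_baseSet_trivializationAt' _))] with z hz hz'
  obtain ⟨h, e⟩ := chartFrame_eq hφ hz
  simp only [Function.comp_apply, e, proj_chartFrame]
  exact (Trivialization.continuousLinearMapAt_apply_of_mem ℝ _ hz' _).symm

end

end ChartFrame

/-! ### Differentiation along generators -/

theorem hasFDerivAt_ringInverse_one {R : Type*} [NormedRing R] [NormedAlgebra ℝ R]
    [CompleteSpace R] : HasFDerivAt Ring.inverse (-ContinuousLinearMap.id ℝ R) (1 : R) := by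
  refine (hasFDerivAt_ringInverse (𝕜 := ℝ) (1 : Rˣ)).congr_fderiv ?_
  ext x
  change -(((1 : Rˣ)⁻¹ : Rˣ) * x * ((1 : Rˣ)⁻¹ : Rˣ)) = -x
  rw [inv_one, Units.val_one, one_mul, mul_one]

section Generators

variable {n : ℕ} {M : Type*} [TopologicalSpace M] [ChartedSpace (Rn n) M] [IsManifold (𝓡 n) ∞ M]

/-- The charts of the unit group are the inclusion into `gl n`, so the inclusion read in a chart is
the identity. -/
theorem hasMFDerivAt_units_val (a : GLn n) :
    HasMFDerivAt 𝓘(ℝ, gl n) 𝓘(ℝ, gl n) (Units.val : GLn n → gl n) a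
      (ContinuousLinearMap.id ℝ (gl n)) := by
  refine ⟨Units.continuous_val.continuousAt, ?_⟩
  refine (hasFDerivWithinAt_id _ _).congr_of_eventuallyEq ?_ ?_
  · have : (chartAt (gl n) a).target ∈ nhds (chartAt (gl n) a a) :=
      (chartAt (gl n) a).open_target.mem_nhds (mem_chart_target _ a)
    filter_upwards [mem_nhdsWithin_of_mem_nhds this] with b hb
    exact (chartAt (gl n) a).right_inv hb
  · exact (chartAt (gl n) a).right_inv (mem_chart_target _ a)

namespace FrameBundle

/-- The frame given by the identification `T_x M = ℝⁿ` in the preferred chart at `x`. -/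
noncomputable def idFrame (x : M) : FrameBundle n M :=
  ⟨⟨x, ContinuousLinearMap.id ℝ (Rn n)⟩, ⟨ContinuousLinearEquiv.refl ℝ (Rn n), rfl⟩⟩

theorem exists_eq_act {u v : FrameBundle n M} (h : v.proj = u.proj) : ∃ a : GLn n, v = u.act a := by
  obtain ⟨⟨x, u⟩, hu⟩ := u
  obtain ⟨⟨x', v⟩, hv⟩ := v
  obtain rfl : x' = x := h
  obtain ⟨e, rfl⟩ : u.IsInvertible := hu
  obtain ⟨f, rfl⟩ : v.IsInvertible := hv
  let f' : Rn n ≃L[ℝ] TangentSpace (𝓡 n) x' := f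
  let e' : Rn n ≃L[ℝ] TangentSpace (𝓡 n) x' := e
  refine ⟨(ContinuousLinearEquiv.unitsEquiv ℝ (Rn n)).symm (f'.trans e'.symm), ?_⟩
  refine Subtype.ext (congrArg (TotalSpace.mk x') ?_)
  ext1 ξ
  exact (e'.apply_symm_apply (f' ξ)).symm

variable {E' : Type*} [NormedAddCommGroup E'] [NormedSpace ℝ E'] {H' : Type*} [TopologicalSpace H']
  {I' : ModelWithCorners ℝ E' H'} {N : Type*} [TopologicalSpace N] [ChartedSpace H' N]

theorem mfderiv_generator {g : FrameBundle n M → N} {u : FrameBundle n M}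
    (hg : MDifferentiableAt (frameModel n) I' g u) (A : gl n) :
    mfderiv (frameModel n) I' g u (u.generator A) =
      mfderiv 𝓘(ℝ, gl n) I' (fun a : GLn n => g (u.act a)) 1 A := by
  have h1 : MDifferentiableAt 𝓘(ℝ, gl n) (frameModel n) (fun a : GLn n => u.act a) 1 :=
    (contMDiff_act_right u 1).mdifferentiableAt (by simp)
  exact (congrArg (fun L => L A) (mfderiv_comp (I' := frameModel n) (1 : GLn n)
    (show MDifferentiableAt (frameModel n) I' g (u.act 1) from hg) h1)).symm

/-- Extending the orbit map `a ↦ g(ua)` from the group to a map `F` on the vector space `gl n`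
reduces derivatives along generators to calculus in `gl n`. -/
theorem mfderiv_generator_of_eq {g : FrameBundle n M → N} {u : FrameBundle n M}
    (hg : MDifferentiableAt (frameModel n) I' g u) {F : gl n → N}
    {F' : gl n →L[ℝ] E'} (hF : HasMFDerivAt 𝓘(ℝ, gl n) I' F 1 F')
    (h : ∀ a : GLn n, g (u.act a) = F a) (A : gl n) :
    mfderiv (frameModel n) I' g u (u.generator A) = F' A := by
  rw [mfderiv_generator hg]
  have h2 : HasMFDerivAt 𝓘(ℝ, gl n) I' (fun a : GLn n => g (u.act a)) 1
      (F'.comp (ContinuousLinearMap.id ℝ (gl n))) := by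
    rw [funext h]
    exact HasMFDerivAt.comp (I' := 𝓘(ℝ, gl n)) (1 : GLn n) hF (hasMFDerivAt_units_val 1)
  rw [h2.mfderiv]
  rfl

theorem mfderiv_proj_generator (u : FrameBundle n M) (A : gl n) :
    mfderiv (frameModel n) (𝓡 n) (proj : FrameBundle n M → M) u (u.generator A) = 0 :=
  mfderiv_generator_of_eq ((contMDiff_proj u).mdifferentiableAt (by simp))
    (F := fun _ => u.proj) (hasMFDerivAt_const _ _) (fun _ => rfl) A

/-- The orbit map is `a ↦ a⁻¹ f_Y(u)`, and inversion has derivative `-id` at the identity;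
`Ring.inverse` is the extension to all of `gl n`. -/
theorem mfderiv_vectorFun_generator {Y : Π x : M, TangentSpace (𝓡 n) x} {u : FrameBundle n M}
    (hY : MDifferentiableAt (𝓡 n) (𝓡 n).tangent
      (fun x => (⟨x, Y x⟩ : TangentBundle (𝓡 n) M)) u.proj) (A : gl n) :
    mfderiv (frameModel n) 𝓘(ℝ, Rn n) (vectorFun Y) u (u.generator A) = - A (vectorFun Y u) := by
  have h1 : HasFDerivAt Ring.inverse (-ContinuousLinearMap.id ℝ (gl n)) 1 :=
    hasFDerivAt_ringInverse_one
  have h2 : HasFDerivAt (fun b : gl n => Ring.inverse b (vectorFun Y u))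
      (-ContinuousLinearMap.apply ℝ (Rn n) (vectorFun Y u)) 1 :=
    ((ContinuousLinearMap.apply ℝ (Rn n) (vectorFun Y u)).hasFDerivAt.comp 1 h1).congr_fderiv
      (ContinuousLinearMap.comp_neg _ _)
  exact mfderiv_generator_of_eq (mdifferentiableAt_vectorFun hY) (HasFDerivAt.hasMFDerivAt h2)
    (fun a => by rw [vectorFun_act, Ring.inverse_unit]) A

/-- Along the orbit, `Φ_w(s(y)a) = s(y)(aw)` has coordinates `(y, aw)`: only the fibre part moves,
linearly in `a`. -/
theorem mfderiv_assoc_generator {φ : OpenPartialHomeomorph M (Rn n)}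
    (hφ : φ ∈ IsManifold.maximalAtlas (𝓡 n) ∞ M) {y : Rn n} (hy : y ∈ φ.target) (w : Rn n)
    (A : gl n) :
    (mfderiv (frameModel n) (𝓡 n).tangent (assoc w : FrameBundle n M → _) (chartFrame φ y)
      ((chartFrame φ y).generator A) : Rn n × Rn n) =
    mfderiv 𝓘(ℝ, Rn n × Rn n) (𝓡 n).tangent (tangentCoordSymm φ : _ → TangentBundle (𝓡 n) M)
      (y, w) (0, A w) := by
  have h1 : HasFDerivAt (fun b : gl n => (y, b w)) _ (1 : gl n) :=
    (hasFDerivAt_const y (1 : gl n)).prodMk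
      ((hasFDerivAt_id (1 : gl n)).clm_apply (hasFDerivAt_const w (1 : gl n)))
  have h2 : HasMFDerivAt 𝓘(ℝ, Rn n × Rn n) (𝓡 n).tangent
      (tangentCoordSymm φ : _ → TangentBundle (𝓡 n) M) (y, (1 : gl n) w) _ :=
    ((contMDiffAt_tangentCoordSymm hφ (p := (y, w)) hy).mdifferentiableAt (by simp)).hasMFDerivAt
  have h3 := HasMFDerivAt.comp (I' := 𝓘(ℝ, Rn n × Rn n)) (1 : gl n) h2 h1.hasMFDerivAt
  refine (mfderiv_generator_of_eq ((contMDiff_assoc w _).mdifferentiableAt (by simp)) h3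
    (fun a => ?_) A).trans ?_
  · exact assoc_chartFrame hφ hy (a.1 w)
  · simp
    rfl

end FrameBundle

end Generators

/-! ### Horizontal lifts and the definition of the spray -/

namespace LinearConnection

open FrameBundle

variable {n : ℕ} {M : Type*} [TopologicalSpace M] [ChartedSpace (Rn n) M] [IsManifold (𝓡 n) ∞ M]
  (C : LinearConnection n M)

theorem exists_mfderiv_proj_eq (u : FrameBundle n M) (w : TangentSpace (𝓡 n) u.proj) :
    ∃ X : TangentSpace (frameModel n) u,
      mfderiv (frameModel n) (𝓡 n) (proj : FrameBundle n M → M) u X = w := by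
  set φ := chartAt (Rn n) u.proj with hφ_def
  have hφ : φ ∈ IsManifold.maximalAtlas (𝓡 n) ∞ M := IsManifold.chart_mem_maximalAtlas _
  have hx : u.proj ∈ φ.source := mem_chart_source _ _
  obtain ⟨y, hy, hyu⟩ : ∃ y ∈ φ.target, φ.symm y = u.proj :=
    ⟨φ u.proj, φ.map_source hx, φ.left_inv hx⟩
  clear_value φ
  -- With `u = s(y)a`, the map `z ↦ s(z)a` is a local section through `u`, and its derivative lifts
  -- tangent vectors.
  obtain ⟨a, rfl⟩ := exists_eq_act (u := chartFrame φ y) (v := u) (by simp [hyu])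
  obtain ⟨w', hw'⟩ := (OpenPartialHomeomorph.mdifferentiable_of_mem_maximalAtlas
    hφ).symm.mfderiv_surjective hy w
  have h1 : MDifferentiableAt 𝓘(ℝ, Rn n) (frameModel n) (fun z => (chartFrame φ z).act a) y :=
    ((contMDiff_act a _).comp y (contMDiffAt_chartFrame hφ hy)).mdifferentiableAt (by simp)
  have h2 : MDifferentiableAt (frameModel n) (𝓡 n) (proj : FrameBundle n M → M)
      ((chartFrame φ y).act a) := (FrameBundle.contMDiff_proj _).mdifferentiableAt (by simp)
  refine ⟨mfderiv 𝓘(ℝ, Rn n) (frameModel n) (fun z => (chartFrame φ z).act a) y w', ?_⟩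
  have h3 := congrArg (fun L => L w') (mfderiv_comp (I' := frameModel n) y h2 h1)
  have h4 : (proj : FrameBundle n M → M) ∘ (fun z => (chartFrame φ z).act a) = φ.symm := by
    ext z; simp
  rw [h4] at h3
  exact h3.symm.trans hw'

/-- The pair of the connection form and the differential of the projection. -/
noncomputable def splitting (u : FrameBundle n M) : Rn n × gl n →L[ℝ] gl n × Rn n :=
  (C.form u : Rn n × gl n →L[ℝ] gl n).prod
    (mfderiv (frameModel n) (𝓡 n) (proj : FrameBundle n M → M) u : Rn n × gl n →L[ℝ] Rn n)

theorem splitting_apply (u : FrameBundle n M) (X : TangentSpace (frameModel n) u) :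
    C.splitting u X =
      (C.form u X, mfderiv (frameModel n) (𝓡 n) (proj : FrameBundle n M → M) u X) := rfl

theorem splitting_surjective (u : FrameBundle n M) : Function.Surjective (C.splitting u) := by
  rintro ⟨A, w⟩
  obtain ⟨X, hX⟩ := exists_mfderiv_proj_eq u w
  -- A generator corrects the value of `ω` without changing the projection.
  refine ⟨(X + u.generator (A - C.form u X) : TangentSpace (frameModel n) u), ?_⟩
  rw [splitting_apply, ContinuousLinearMap.map_add, ContinuousLinearMap.map_add, C.form_generator,
    mfderiv_proj_generator, hX]
  exact Prod.ext (add_sub_cancel _ _) (add_zero w)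

theorem splitting_bijective (u : FrameBundle n M) : Function.Bijective (C.splitting u) :=
  ⟨(LinearMap.injective_iff_surjective_of_finrank_eq_finrank
    (f := (C.splitting u : Rn n × gl n →ₗ[ℝ] gl n × Rn n))
    (by rw [Module.finrank_prod, Module.finrank_prod, add_comm])).2 (C.splitting_surjective u),
    C.splitting_surjective u⟩

/-- `T_u L(M)` splits as `𝔤𝔩(n; ℝ) × T_{π(u)} M`, by `ω` and the differential of the projection. -/
noncomputable def splittingEquiv (u : FrameBundle n M) : (Rn n × gl n) ≃L[ℝ] gl n × Rn n :=
  (LinearEquiv.ofBijective (C.splitting u : Rn n × gl n →ₗ[ℝ] gl n × Rn n)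
    (C.splitting_bijective u)).toContinuousLinearEquiv

/-- The horizontal lift of tangent vectors to the frame `u`. -/
noncomputable def horizontalLift (u : FrameBundle n M) :
    TangentSpace (𝓡 n) u.proj →L[ℝ] TangentSpace (frameModel n) u :=
  ((C.splittingEquiv u).symm : gl n × Rn n →L[ℝ] Rn n × gl n).comp
    (ContinuousLinearMap.inr ℝ (gl n) (Rn n))

theorem splitting_horizontalLift (u : FrameBundle n M) (w : TangentSpace (𝓡 n) u.proj) :
    C.splitting u (C.horizontalLift u w) = (0, w) :=
  (C.splittingEquiv u).apply_symm_apply (0, w)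

theorem form_horizontalLift (u : FrameBundle n M) (w : TangentSpace (𝓡 n) u.proj) :
    C.form u (C.horizontalLift u w) = 0 :=
  congrArg Prod.fst (C.splitting_horizontalLift u w)

theorem mfderiv_proj_horizontalLift (u : FrameBundle n M) (w : TangentSpace (𝓡 n) u.proj) :
    mfderiv (frameModel n) (𝓡 n) (proj : FrameBundle n M → M) u (C.horizontalLift u w) = w :=
  congrArg Prod.snd (C.splitting_horizontalLift u w)

theorem eq_horizontalLift {u : FrameBundle n M} {X : TangentSpace (frameModel n) u}
    (hX : C.form u X = 0) {w : TangentSpace (𝓡 n) u.proj}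
    (hw : mfderiv (frameModel n) (𝓡 n) (proj : FrameBundle n M → M) u X = w) :
    X = C.horizontalLift u w :=
  (C.splitting_bijective u).1 <| by rw [splitting_horizontalLift, splitting_apply, hX, hw]

theorem existsUnique_isStandardHorizontal (ξ : Rn n) (u : FrameBundle n M) :
    ∃! X, C.IsStandardHorizontal ξ u X :=
  ⟨C.horizontalLift u (u.map ξ), ⟨C.form_horizontalLift u _, C.mfderiv_proj_horizontalLift u _⟩,
    fun _ hX => C.eq_horizontalLift hX.1 hX.2⟩

theorem isStandardHorizontal_standardHorizontal (ξ : Rn n) (u : FrameBundle n M) :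
    C.IsStandardHorizontal ξ u (C.standardHorizontal ξ u) :=
  Classical.epsilon_spec (C.existsUnique_isStandardHorizontal ξ u).exists

theorem IsStandardHorizontal.eq {C : LinearConnection n M} {ξ : Rn n} {u : FrameBundle n M}
    {X : TangentSpace (frameModel n) u} (hX : C.IsStandardHorizontal ξ u X) :
    X = C.standardHorizontal ξ u :=
  (C.existsUnique_isStandardHorizontal ξ u).unique hX
    (C.isStandardHorizontal_standardHorizontal ξ u)

theorem mfderiv_comp_act {E' : Type*} [NormedAddCommGroup E'] [NormedSpace ℝ E'] {H' : Type*}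
    [TopologicalSpace H'] {I' : ModelWithCorners ℝ E' H'} {N : Type*} [TopologicalSpace N]
    [ChartedSpace H' N] {g : FrameBundle n M → N} {u : FrameBundle n M} {a : GLn n}
    (hg : MDifferentiableAt (frameModel n) I' g (u.act a)) (X : TangentSpace (frameModel n) u) :
    mfderiv (frameModel n) I' (fun w : FrameBundle n M => g (w.act a)) u X =
      mfderiv (frameModel n) I' g (u.act a)
        (mfderiv (frameModel n) (frameModel n) (fun w : FrameBundle n M => w.act a) u X) :=
  congrArg (fun L => L X) (mfderiv_comp (I' := frameModel n) u hg
    ((contMDiff_act a u).mdifferentiableAt (by simp)))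

/-- `Ad(a⁻¹)` preserves zero, `π ∘ R_a = π`, and `(ua)ξ = u(aξ)`. -/
theorem IsStandardHorizontal.act {C : LinearConnection n M} {ξ : Rn n} {u : FrameBundle n M}
    {a : GLn n} {X : TangentSpace (frameModel n) u}
    (hX : C.IsStandardHorizontal ((a : gl n) ξ) u X) :
    C.IsStandardHorizontal ξ (u.act a)
      (mfderiv (frameModel n) (frameModel n) (fun w : FrameBundle n M => w.act a) u X) := by
  refine ⟨by rw [C.form_act, hX.1, mul_zero, zero_mul], ?_⟩
  rw [← mfderiv_comp_act ((FrameBundle.contMDiff_proj _).mdifferentiableAt (by simp))]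
  exact hX.2

/-- This is the well-definedness of `Z`: the chain rule for `Φ_ξ ∘ R_a = Φ_{aξ}`. -/
theorem mfderiv_assoc_act (ξ : Rn n) (u : FrameBundle n M) (a : GLn n) :
    (mfderiv (frameModel n) (𝓡 n).tangent (assoc ξ : FrameBundle n M → _) (u.act a)
      (C.standardHorizontal ξ (u.act a)) : Rn n × Rn n) =
    mfderiv (frameModel n) (𝓡 n).tangent (assoc ((a : gl n) ξ) : FrameBundle n M → _) u
      (C.standardHorizontal ((a : gl n) ξ) u) := by
  rw [← (C.isStandardHorizontal_standardHorizontal ((a : gl n) ξ) u).act.eq]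
  exact (mfderiv_comp_act ((contMDiff_assoc ξ _).mdifferentiableAt (by simp)) _).symm

/-- The geodesic spray of a linear connection. -/
noncomputable def geodesicSpray (v : TangentBundle (𝓡 n) M) : TangentSpace (𝓡 n).tangent v :=
  mfderiv (frameModel n) (𝓡 n).tangent (assoc v.2 : FrameBundle n M → _) (idFrame v.1)
    (C.standardHorizontal v.2 (idFrame v.1))

theorem isGeodesicSpray_geodesicSpray : C.IsGeodesicSpray C.geodesicSpray := by
  intro u ξ
  obtain ⟨x, hx⟩ : ∃ x, x = u.proj := ⟨_, rfl⟩
  obtain ⟨a, rfl⟩ := exists_eq_act (u := idFrame x) (v := u) hx.symm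
  exact (C.mfderiv_assoc_act ξ _ a).symm

/-- Every `v` has the form `uξ`, with `u` the identity frame and `ξ = v`, so the defining property
leaves no freedom. -/
theorem IsGeodesicSpray.eq {C : LinearConnection n M}
    {Z : Π v : TangentBundle (𝓡 n) M, TangentSpace (𝓡 n).tangent v} (hZ : C.IsGeodesicSpray Z) :
    Z = C.geodesicSpray :=
  funext fun v => hZ (idFrame v.1) v.2

/-- Since `τ_M ∘ Φ_ξ = π`, this is the projection property of `B(ξ)`. -/
theorem mfderiv_proj_geodesicSpray (v : TangentBundle (𝓡 n) M) :
    mfderiv (𝓡 n).tangent (𝓡 n) (TotalSpace.proj : TangentBundle (𝓡 n) M → M) v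
      (C.geodesicSpray v) = v.2 := by
  have h1 : MDifferentiableAt (frameModel n) (𝓡 n).tangent (assoc v.2 : FrameBundle n M → _)
      (idFrame v.1) := (contMDiff_assoc _ _).mdifferentiableAt (by simp)
  have h2 : MDifferentiableAt (𝓡 n).tangent (𝓡 n) (TotalSpace.proj : TangentBundle (𝓡 n) M → M)
      (assoc v.2 (idFrame v.1)) := mdifferentiableAt_proj _
  have h3 := congrArg (fun L => L (C.standardHorizontal v.2 (idFrame v.1)))
    (mfderiv_comp (I' := (𝓡 n).tangent) _ h2 h1)
  exact h3.symm.trans (C.isStandardHorizontal_standardHorizontal v.2 (idFrame v.1)).2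

/-! ### The associated affine connection -/

theorem horizontalLift_act (u : FrameBundle n M) (a : GLn n) (w : TangentSpace (𝓡 n) u.proj) :
    mfderiv (frameModel n) (frameModel n) (fun w : FrameBundle n M => w.act a) u
      (C.horizontalLift u w) = C.horizontalLift (u.act a) w := by
  apply C.eq_horizontalLift
  · rw [C.form_act, form_horizontalLift, mul_zero, zero_mul]
  · rw [← mfderiv_comp_act ((FrameBundle.contMDiff_proj _).mdifferentiableAt (by simp))]
    exact C.mfderiv_proj_horizontalLift u w

end LinearConnection

/-! ### Chart formula for the spray, and the affine connection -/

namespace LinearConnection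

open FrameBundle

variable {n : ℕ} {M : Type*} [TopologicalSpace M] [ChartedSpace (Rn n) M] [IsManifold (𝓡 n) ∞ M]
  (C : LinearConnection n M) {φ : OpenPartialHomeomorph M (Rn n)}

/-- The connection form in the frame of a chart `φ`: the Christoffel symbols, as the linear map
`w ↦ (Γ^i_{jk} w^j)_{i,k}`. -/
noncomputable def localForm (φ : OpenPartialHomeomorph M (Rn n)) (y : Rn n) : Rn n →L[ℝ] gl n :=
  (C.form (chartFrame φ y) : Rn n × gl n →L[ℝ] gl n).comp
    (mfderiv 𝓘(ℝ, Rn n) (frameModel n) (chartFrame φ) y : Rn n →L[ℝ] Rn n × gl n)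

/-- `Ts(w)` already projects to `s(y)w`; subtracting the vertical generator of its `ω`-value makes
it horizontal. -/
theorem standardHorizontal_chartFrame (hφ : φ ∈ IsManifold.maximalAtlas (𝓡 n) ∞ M) {y : Rn n}
    (hy : y ∈ φ.target) (w : Rn n) :
    C.standardHorizontal w (chartFrame φ y) =
      mfderiv 𝓘(ℝ, Rn n) (frameModel n) (chartFrame φ) y w -
        (chartFrame φ y).generator (C.localForm φ y w) := by
  refine (IsStandardHorizontal.eq ⟨?_, ?_⟩).symm
  · rw [ContinuousLinearMap.map_sub, form_generator]
    exact sub_self _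
  · rw [ContinuousLinearMap.map_sub, mfderiv_proj_generator]
    refine (sub_zero _).trans ?_
    have h1 : MDifferentiableAt 𝓘(ℝ, Rn n) (frameModel n) (chartFrame φ) y :=
      (contMDiffAt_chartFrame hφ hy).mdifferentiableAt (by simp)
    have h2 : MDifferentiableAt (frameModel n) (𝓡 n) (proj : FrameBundle n M → M) (chartFrame φ y) :=
      (FrameBundle.contMDiff_proj _).mdifferentiableAt (by simp)
    have h3 := congrArg (fun L => L w) (mfderiv_comp (I' := frameModel n) y h2 h1)
    have h4 : (proj : FrameBundle n M → M) ∘ chartFrame φ = φ.symm := by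
      ext z; simp
    rw [h4] at h3
    refine h3.symm.trans ?_
    obtain ⟨h, e⟩ := chartFrame_eq hφ hy
    rw [e]
    rfl

theorem mfderiv_assoc_standardHorizontal (hφ : φ ∈ IsManifold.maximalAtlas (𝓡 n) ∞ M) {y : Rn n}
    (hy : y ∈ φ.target) (w : Rn n) :
    (mfderiv (frameModel n) (𝓡 n).tangent (assoc w : FrameBundle n M → _) (chartFrame φ y)
      (C.standardHorizontal w (chartFrame φ y)) : Rn n × Rn n) =
    mfderiv 𝓘(ℝ, Rn n × Rn n) (𝓡 n).tangent (tangentCoordSymm φ : _ → TangentBundle (𝓡 n) M)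
      (y, w) (w, -C.localForm φ y w w) := by
  rw [C.standardHorizontal_chartFrame hφ hy, ContinuousLinearMap.map_sub]
  have h1 : MDifferentiableAt 𝓘(ℝ, Rn n) (frameModel n) (chartFrame φ) y :=
    (contMDiffAt_chartFrame hφ hy).mdifferentiableAt (by simp)
  have h2 : MDifferentiableAt (frameModel n) (𝓡 n).tangent (assoc w : FrameBundle n M → _)
      (chartFrame φ y) := (contMDiff_assoc w _).mdifferentiableAt (by simp)
  have h3 := congrArg (fun L => L w) (mfderiv_comp (I' := frameModel n) y h2 h1)
  have h4 : HasMFDerivAt 𝓘(ℝ, Rn n × Rn n) (𝓡 n).tangent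
      (tangentCoordSymm φ : _ → TangentBundle (𝓡 n) M) (y, w) _ :=
    ((contMDiffAt_tangentCoordSymm hφ (p := (y, w)) hy).mdifferentiableAt (by simp)).hasMFDerivAt
  have h5 : HasFDerivAt (fun z : Rn n => (z, w)) _ y :=
    (hasFDerivAt_id (𝕜 := ℝ) y).prodMk (hasFDerivAt_const w y)
  have h6 := HasMFDerivAt.comp (I' := 𝓘(ℝ, Rn n × Rn n)) y h4 h5.hasMFDerivAt
  -- Along `s` the vector `Φ_w` keeps its fibre coordinates `w`, so `Ts(w)` contributes `(w, 0)`.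
  have h7 : assoc w ∘ chartFrame φ =ᶠ[nhds y]
      (tangentCoordSymm φ : _ → TangentBundle (𝓡 n) M) ∘ (fun z : Rn n => (z, w)) := by
    filter_upwards [φ.open_target.mem_nhds hy] with z hz
    exact assoc_chartFrame hφ hz w
  have h8 := congrArg (fun L => L w) (h6.congr_of_eventuallyEq h7).mfderiv
  have h9 : (w, -C.localForm φ y w w) = (w, (0 : Rn n)) - (0, C.localForm φ y w w) := by simp
  refine (congrArg₂ (fun a b : Rn n × Rn n => a - b) (h3.symm.trans h8)
    (mfderiv_assoc_generator hφ hy w (C.localForm φ y w))).trans ?_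
  rw [h9]
  exact ((mfderiv 𝓘(ℝ, Rn n × Rn n) (𝓡 n).tangent (tangentCoordSymm φ : _ → TangentBundle (𝓡 n) M)
    (y, w) : Rn n × Rn n →L[ℝ] Rn n × Rn n).map_sub _ _).symm

/-! ### The associated affine connection -/

/-- The affine connection `∇` that corresponds to a linear connection. -/
noncomputable def affineConnection :
    CovariantDerivative (𝓡 n) (Rn n) (TangentSpace (𝓡 n) : M → Type) where
  toFun Y x := (idFrame x).map.comp
    ((mfderiv (frameModel n) 𝓘(ℝ, Rn n) (vectorFun Y) (idFrame x)).comp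
      (C.horizontalLift (idFrame x)))
  isCovariantDerivativeOnUniv :=
    { add := by
        intro Y Y' x hY hY' _
        have h : (vectorFun (Y + Y') : FrameBundle n M → Rn n) = vectorFun Y + vectorFun Y' := by
          ext1 u
          exact ContinuousLinearMap.map_add _ _ _
        have h1 := mdifferentiableAt_vectorFun (u := idFrame x) hY
        have h2 := mdifferentiableAt_vectorFun (u := idFrame x) hY'
        rw [h, mfderiv_add h1 h2]
        rfl
      leibniz := by
        intro Y g x hY hg _
        have h : (vectorFun (g • Y) : FrameBundle n M → Rn n) =
            (fun u : FrameBundle n M => g u.proj) • vectorFun Y := by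
          ext1 u
          exact ContinuousLinearMap.map_smul _ _ _
        have hp : MDifferentiableAt (frameModel n) (𝓡 n) (proj : FrameBundle n M → M) (idFrame x) :=
          (FrameBundle.contMDiff_proj _).mdifferentiableAt (by simp)
        have h1 := mdifferentiableAt_vectorFun (u := idFrame x) hY
        have h2 : MDifferentiableAt (frameModel n) 𝓘(ℝ, ℝ) (fun u : FrameBundle n M => g u.proj)
            (idFrame x) := MDifferentiableAt.comp (I' := 𝓡 n) (idFrame x) hg hp
        ext1 w
        set X := C.horizontalLift (idFrame x) w with hX
        -- The horizontal lift of `w` differentiates `g ∘ π` as `w` differentiates `g`; this is the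
        -- extra term in the Leibniz rule.
        have h3 : mvfderiv (frameModel n) (fun u : FrameBundle n M => g u.proj) (idFrame x) X =
            mvfderiv (𝓡 n) g x w :=
          (congrArg (fun L => L X) (mfderiv_comp (I' := 𝓡 n) (idFrame x) hg hp)).trans
            (congrArg (mfderiv (𝓡 n) 𝓘(ℝ, ℝ) g x) (C.mfderiv_proj_horizontalLift (idFrame x) w))
        have h4 : (mvfderiv (frameModel n) (vectorFun (g • Y)) (idFrame x) X : Rn n) =
            g x • mvfderiv (frameModel n) (vectorFun Y) (idFrame x) X +
              mvfderiv (𝓡 n) g x w • vectorFun Y (idFrame x) := by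
          rw [h, mvfderiv_smul h2 h1, ← h3]
          rfl
        change (idFrame x).map (mvfderiv (frameModel n) (vectorFun (g • Y)) (idFrame x) X) = _
        rw [h4, ContinuousLinearMap.map_add, ContinuousLinearMap.map_smul,
          ContinuousLinearMap.map_smul, map_vectorFun]
        rfl }

theorem mfderiv_vectorFun_act {Y : Π x : M, TangentSpace (𝓡 n) x} {u : FrameBundle n M}
    (hY : MDifferentiableAt (𝓡 n) (𝓡 n).tangent
      (fun x => (⟨x, Y x⟩ : TangentBundle (𝓡 n) M)) u.proj) (a : GLn n)
    (X : TangentSpace (frameModel n) u) :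
    mfderiv (frameModel n) 𝓘(ℝ, Rn n) (vectorFun Y) (u.act a)
      (mfderiv (frameModel n) (frameModel n) (fun w : FrameBundle n M => w.act a) u X) =
    ((a⁻¹ : GLn n) : gl n) (mfderiv (frameModel n) 𝓘(ℝ, Rn n) (vectorFun Y) u X) := by
  rw [← mfderiv_comp_act (mdifferentiableAt_vectorFun (u := u.act a) hY)]
  have h : (fun w : FrameBundle n M => vectorFun Y (w.act a)) =
      ((a⁻¹ : GLn n) : gl n) ∘ vectorFun Y := funext fun w => vectorFun_act Y w a
  rw [h]
  have h1 : HasMFDerivAt 𝓘(ℝ, Rn n) 𝓘(ℝ, Rn n) ((a⁻¹ : GLn n) : gl n) (vectorFun Y u)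
    ((a⁻¹ : GLn n) : gl n) := ((a⁻¹ : GLn n) : gl n).hasMFDerivAt
  exact congrArg (fun L => L X) (HasMFDerivAt.comp (I' := 𝓘(ℝ, Rn n)) u h1
    (mdifferentiableAt_vectorFun hY).hasMFDerivAt).mfderiv

/-- For `u = ea`, with `e` the identity frame, the factor `a⁻¹` from `f_Y` cancels the `a` in the
frame. -/
theorem corresponds_affineConnection : C.Corresponds C.affineConnection := by
  intro u X hX Y hY
  obtain ⟨x, hx⟩ : ∃ x, x = u.proj := ⟨_, rfl⟩
  obtain ⟨a, rfl⟩ := exists_eq_act (u := idFrame x) (v := u) hx.symm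
  obtain ⟨w, rfl⟩ : ∃ w, X = C.horizontalLift _ w := ⟨_, C.eq_horizontalLift hX rfl⟩
  rw [mfderiv_proj_horizontalLift]
  refine Eq.trans ?_ (congrArg (fun X => ((idFrame x).act a).map
    (mfderiv (frameModel n) 𝓘(ℝ, Rn n) (vectorFun Y) ((idFrame x).act a) X))
    (C.horizontalLift_act (idFrame x) a w))
  rw [mfderiv_vectorFun_act (u := idFrame x) hY, map_act]
  exact congrArg (idFrame x).map (congrArg (fun L : gl n => L (mfderiv (frameModel n) 𝓘(ℝ, Rn n)
    (vectorFun Y) (idFrame x) (C.horizontalLift (idFrame x) w))) a.mul_inv).symm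

/-! ### Coordinates -/

omit [IsManifold (𝓡 n) ∞ M] in
theorem fibreCoord_mfderiv_symm (hφ : φ ∈ IsManifold.maximalAtlas (𝓡 n) ∞ M) {y : Rn n}
    (hy : y ∈ φ.target) (w : Rn n) :
    fibreCoord φ (mfderiv 𝓘(ℝ, Rn n) (𝓡 n) φ.symm y w) = w :=
  congrArg (fun L => L w) ((OpenPartialHomeomorph.mdifferentiable_of_mem_maximalAtlas
    hφ).comp_symm_deriv hy)

omit [IsManifold (𝓡 n) ∞ M] in
theorem tangentCoordSymm_fibreCoord (hφ : φ ∈ IsManifold.maximalAtlas (𝓡 n) ∞ M)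
    {v : TangentBundle (𝓡 n) M} (hv : v.1 ∈ φ.source) :
    tangentCoordSymm φ (φ v.1, fibreCoord φ v.2) = v := by
  obtain ⟨x, v⟩ := v
  have h1 := congrArg (fun L => L v) ((OpenPartialHomeomorph.mdifferentiable_of_mem_maximalAtlas
    hφ).symm_comp_deriv hv)
  have h2 : ∀ {x' : M} {v' : Rn n}, x' = x → v' = v → (⟨x', v'⟩ : TangentBundle (𝓡 n) M) = ⟨x, v⟩ := by
    rintro _ _ rfl rfl; rfl
  exact h2 (φ.left_inv hv) h1

theorem geodesicSpray_eq (hφ : φ ∈ IsManifold.maximalAtlas (𝓡 n) ∞ M)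
    {v : TangentBundle (𝓡 n) M} (hv : v.1 ∈ φ.source) :
    C.geodesicSpray v = mfderiv 𝓘(ℝ, Rn n × Rn n) (𝓡 n).tangent
      (tangentCoordSymm φ : _ → TangentBundle (𝓡 n) M) (φ v.1, fibreCoord φ v.2)
      (fibreCoord φ v.2, -C.localForm φ (φ v.1) (fibreCoord φ v.2) (fibreCoord φ v.2)) := by
  have hy := φ.map_source hv
  have h1 : assoc (fibreCoord φ v.2) (chartFrame φ (φ v.1)) = v := by
    rw [assoc_chartFrame hφ hy, tangentCoordSymm_fibreCoord hφ hv]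
  -- The two values lie in different tangent spaces, both definitionally `ℝⁿ × ℝⁿ`; comparing them
  -- there avoids a cast.
  have h2 : ∀ v', v' = v → (C.geodesicSpray v' : Rn n × Rn n) = C.geodesicSpray v := by
    rintro _ rfl; rfl
  exact (h2 _ h1).symm.trans ((C.isGeodesicSpray_geodesicSpray _ _).trans
    (C.mfderiv_assoc_standardHorizontal hφ hy _))

omit [IsManifold (𝓡 n) ∞ M] in
theorem coordField_symm {y : Rn n} (hy : y ∈ φ.target) (i : Fin n) :
    (coordField φ i (φ.symm y) : Rn n) =
      mfderiv 𝓘(ℝ, Rn n) (𝓡 n) φ.symm y (EuclideanSpace.single i 1) := by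
  have h : ∀ y', y' = y → (mfderiv 𝓘(ℝ, Rn n) (𝓡 n) φ.symm y' (EuclideanSpace.single i 1) : Rn n) =
      mfderiv 𝓘(ℝ, Rn n) (𝓡 n) φ.symm y (EuclideanSpace.single i 1) := by
    rintro _ rfl; rfl
  exact h _ (φ.right_inv hy)

theorem mdifferentiableAt_coordField (hφ : φ ∈ IsManifold.maximalAtlas (𝓡 n) ∞ M) {x : M}
    (hx : x ∈ φ.source) (i : Fin n) :
    MDifferentiableAt (𝓡 n) (𝓡 n).tangent
      (fun x => (⟨x, coordField φ i x⟩ : TangentBundle (𝓡 n) M)) x := by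
  have h1 : ContMDiffAt (𝓡 n) 𝓘(ℝ, Rn n × Rn n) ∞
      (fun z => (φ z, (EuclideanSpace.single i 1 : Rn n))) x :=
    (contMDiffAt_of_mem_maximalAtlas hφ hx).prodMk_space contMDiffAt_const
  have h2 := (contMDiffAt_tangentCoordSymm hφ (p := (φ x, (EuclideanSpace.single i 1 : Rn n)))
    (φ.map_source hx)).comp x h1
  refine (h2.mdifferentiableAt (by simp)).congr_of_eventuallyEq ?_
  filter_upwards [φ.open_source.mem_nhds hx] with z hz
  have h3 : ∀ {z' : M} (w : Rn n), z' = z →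
      (⟨z, w⟩ : TangentBundle (𝓡 n) M) = (⟨z', w⟩ : TangentBundle (𝓡 n) M) := by
    rintro _ _ rfl; rfl
  exact h3 _ (φ.left_inv hz)

/-- As `f_Y` is constant along `s`, only the subtracted generator contributes, and its two minus
signs cancel. -/
theorem mfderiv_vectorFun_standardHorizontal (hφ : φ ∈ IsManifold.maximalAtlas (𝓡 n) ∞ M)
    {y : Rn n} (hy : y ∈ φ.target) {Y : Π x : M, TangentSpace (𝓡 n) x}
    (hY : MDifferentiableAt (𝓡 n) (𝓡 n).tangent
      (fun x => (⟨x, Y x⟩ : TangentBundle (𝓡 n) M)) (chartFrame φ y).proj) {η : Rn n}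
    (hη : ∀ z ∈ φ.target, vectorFun Y (chartFrame φ z) = η) (w : Rn n) :
    mfderiv (frameModel n) 𝓘(ℝ, Rn n) (vectorFun Y) (chartFrame φ y)
      (C.standardHorizontal w (chartFrame φ y)) = C.localForm φ y w η := by
  have h1 : MDifferentiableAt 𝓘(ℝ, Rn n) (frameModel n) (chartFrame φ) y :=
    (contMDiffAt_chartFrame hφ hy).mdifferentiableAt (by simp)
  have h2 := congrArg (fun L => L w)
    (mfderiv_comp (I' := frameModel n) y (mdifferentiableAt_vectorFun hY) h1)
  have h3 : HasMFDerivAt 𝓘(ℝ, Rn n) 𝓘(ℝ, Rn n) (vectorFun Y ∘ chartFrame φ) y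
      (0 : Rn n →L[ℝ] Rn n) := by
    refine (hasMFDerivAt_const η y).congr_of_eventuallyEq ?_
    filter_upwards [φ.open_target.mem_nhds hy] with z hz using hη z hz
  rw [C.standardHorizontal_chartFrame hφ hy, ContinuousLinearMap.map_sub,
    mfderiv_vectorFun_generator hY, hη y hy]
  rw [h3.mfderiv] at h2
  refine (congrArg (fun a : Rn n => a - -C.localForm φ y w η) h2.symm).trans ?_
  exact (sub_neg_eq_add _ _).trans (zero_add _)

/-- The correspondence is applied to `Y = ∂_k` and `X^h = B(e_j)` at `s(y)`, where `f_Y ∘ s` is the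
constant `e_k`. -/
theorem christoffel_eq {cov : CovariantDerivative (𝓡 n) (Rn n) (TangentSpace (𝓡 n) : M → Type)}
    (hcov : C.Corresponds cov) (hφ : φ ∈ IsManifold.maximalAtlas (𝓡 n) ∞ M) {x : M}
    (hx : x ∈ φ.source) (i j k : Fin n) :
    christoffel cov φ i j k x =
      C.localForm φ (φ x) (EuclideanSpace.single j 1) (EuclideanSpace.single k 1) i := by
  obtain ⟨y, hy, rfl⟩ : ∃ y ∈ φ.target, φ.symm y = x := ⟨φ x, φ.map_source hx, φ.left_inv hx⟩
  rw [φ.right_inv hy]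
  have hY : MDifferentiableAt (𝓡 n) (𝓡 n).tangent
      (fun x => (⟨x, coordField φ k x⟩ : TangentBundle (𝓡 n) M)) (chartFrame φ y).proj := by
    rw [proj_chartFrame]; exact mdifferentiableAt_coordField hφ hx k
  have hη : ∀ z ∈ φ.target, vectorFun (coordField φ k) (chartFrame φ z) =
      EuclideanSpace.single k 1 := by
    intro z hz
    apply vectorFun_eq_of_map_eq
    obtain ⟨h, e⟩ := chartFrame_eq hφ hz
    rw [e]
    exact (coordField_symm hz k).symm
  have hX := C.isStandardHorizontal_standardHorizontal (EuclideanSpace.single j 1) (chartFrame φ y)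
  have key := hcov _ _ hX.1 _ hY
  rw [hX.2, C.mfderiv_vectorFun_standardHorizontal hφ hy hY hη] at key
  generalize C.localForm φ y (EuclideanSpace.single j 1) (EuclideanSpace.single k 1) = r at key ⊢
  obtain ⟨h, e⟩ := chartFrame_eq hφ hy
  rw [e] at key
  refine congrArg (fun v : Rn n => v i) (Eq.trans ?_ (fibreCoord_mfderiv_symm hφ hy r))
  refine congrArg (fun v : Rn n => (fibreCoord φ (x := φ.symm y) v : Rn n)) (Eq.trans ?_ key)
  exact congrArg (cov (coordField φ k) (φ.symm y)) (coordField_symm hy j)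

theorem eq_sum_smul_single (p q : Rn n) :
    (p, -q) = ∑ i, p i • ((EuclideanSpace.single i 1, 0) : Rn n × Rn n) -
      ∑ i, q i • ((0, EuclideanSpace.single i 1) : Rn n × Rn n) := by
  refine Prod.ext ?_ ?_
  · ext j
    simp [Prod.fst_sum, Pi.single_apply]
  · ext j
    simp [Prod.snd_sum, Pi.single_apply]

theorem apply_apply_eq_sum (B : Rn n →L[ℝ] gl n) (w : Rn n) (i : Fin n) :
    B w w i = ∑ j, ∑ k, B (EuclideanSpace.single j 1) (EuclideanSpace.single k 1) i * w j * w k := by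
  have h : w = ∑ j, w j • (EuclideanSpace.single j 1 : Rn n) := by
    ext j; simp [Pi.single_apply]
  have h1 : ∀ A : gl n, A w i = ∑ k, w k * A (EuclideanSpace.single k 1) i := by
    intro A
    conv_lhs => rw [h]
    simp
  have h2 : ∀ v : Rn n, B w v i = ∑ j, w j * B (EuclideanSpace.single j 1) v i := by
    intro v
    conv_lhs => rw [h]
    simp
  rw [h2]
  refine Finset.sum_congr rfl fun j _ => ?_
  rw [h1, Finset.mul_sum]
  exact Finset.sum_congr rfl fun k _ => by ring

theorem geodesicSpray_eq_sum
    {cov : CovariantDerivative (𝓡 n) (Rn n) (TangentSpace (𝓡 n) : M → Type)}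
    (hcov : C.Corresponds cov) (hφ : φ ∈ IsManifold.maximalAtlas (𝓡 n) ∞ M)
    {v : TangentBundle (𝓡 n) M} (hv : v.1 ∈ φ.source) :
    C.geodesicSpray v = ∑ i, fibreCoord φ v.2 i • tangentCoordFieldX φ i v
      - ∑ i, (∑ j, ∑ k, christoffel cov φ i j k v.1 *
          fibreCoord φ v.2 j * fibreCoord φ v.2 k) • tangentCoordFieldV φ i v := by
  rw [C.geodesicSpray_eq hφ hv]
  simp only [C.christoffel_eq hcov hφ hv, ← apply_apply_eq_sum]
  generalize C.localForm φ (φ v.1) (fibreCoord φ v.2) (fibreCoord φ v.2) = q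
  rw [eq_sum_smul_single]
  have h : ∀ D : Rn n × Rn n →L[ℝ] Rn n × Rn n, ∀ p : Rn n,
      D (∑ i, p i • ((EuclideanSpace.single i 1, 0) : Rn n × Rn n) -
        ∑ i, q i • ((0, EuclideanSpace.single i 1) : Rn n × Rn n)) =
      ∑ i, p i • D (EuclideanSpace.single i 1, 0) -
        ∑ i, q i • D (0, EuclideanSpace.single i 1) := by
    intro D p
    simp only [map_sub, map_sum, map_smul]
  exact h _ _

end LinearConnection

/-! ### Smoothness of the spray -/

namespace LinearConnection

open FrameBundle

variable {n : ℕ} {M : Type*} [TopologicalSpace M] [ChartedSpace (Rn n) M] [IsManifold (𝓡 n) ∞ M]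
  (C : LinearConnection n M) {φ : OpenPartialHomeomorph M (Rn n)}

/-- It is `ω`, as a smooth function on `T L(M)`, composed with the tangent map of `s`, taken within
the open set where `s` is smooth. -/
theorem contMDiffAt_localForm (hφ : φ ∈ IsManifold.maximalAtlas (𝓡 n) ∞ M) {p : Rn n × Rn n}
    (hp : p.1 ∈ φ.target) :
    ContMDiffAt 𝓘(ℝ, Rn n × Rn n) 𝓘(ℝ, gl n) ∞ (fun q => C.localForm φ q.1 q.2) p := by
  have hs : ContMDiffOn 𝓘(ℝ, Rn n) (frameModel n) ∞ (chartFrame φ) φ.target :=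
    fun y hy => (contMDiffAt_chartFrame hφ hy).contMDiffWithinAt
  have h1 : ContMDiffAt 𝓘(ℝ, Rn n).tangent (frameModel n).tangent ∞
      (tangentMapWithin 𝓘(ℝ, Rn n) (frameModel n) (chartFrame φ) φ.target) ⟨p.1, p.2⟩ :=
    (hs.contMDiffOn_tangentMapWithin le_rfl φ.open_target.uniqueMDiffOn).contMDiffAt
      ((φ.open_target.preimage (FiberBundle.continuous_proj _ _)).mem_nhds hp)
  have h2 : ContMDiffAt 𝓘(ℝ, Rn n × Rn n) 𝓘(ℝ, Rn n).tangent ∞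
      (fun q : Rn n × Rn n => (⟨q.1, q.2⟩ : TangentBundle 𝓘(ℝ, Rn n) (Rn n))) p := by
    refine contMDiffAt_totalSpace.2 ⟨contDiffAt_fst.contMDiffAt, ?_⟩
    simp only [trivializationAt_model_space_apply]
    exact contDiffAt_snd.contMDiffAt
  refine (C.smooth.contMDiffAt.comp p (h1.comp p h2)).congr_of_eventuallyEq ?_
  filter_upwards [continuous_fst.continuousAt.preimage_mem_nhds (φ.open_target.mem_nhds hp)]
    with q hq
  simp only [Function.comp_apply, tangentMapWithin, mfderivWithin_of_isOpen φ.open_target hq]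
  rfl

theorem extChartAt_tangentBundle_apply {v₀ v : TangentBundle (𝓡 n) M}
    (hv : v.1 ∈ (chartAt (Rn n) v₀.1).source) :
    extChartAt (𝓡 n).tangent v₀ v =
      (chartAt (Rn n) v₀.1 v.1, fibreCoord (chartAt (Rn n) v₀.1) v.2) := by
  have h := tangentMap_chart (I := 𝓡 n) (p := v₀) (q := v) hv
  exact (congrArg (TotalSpace.toProd (Rn n) (Rn n)) h).symm

theorem extChartAt_tangentCoordSymm (v₀ : TangentBundle (𝓡 n) M) {p : Rn n × Rn n}
    (hp : p.1 ∈ (chartAt (Rn n) v₀.1).target) :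
    extChartAt (𝓡 n).tangent v₀ (tangentCoordSymm (chartAt (Rn n) v₀.1) p) = p := by
  rw [extChartAt_tangentBundle_apply ((chartAt (Rn n) v₀.1).map_target hp)]
  exact Prod.ext ((chartAt (Rn n) v₀.1).right_inv hp)
    (fibreCoord_mfderiv_symm (IsManifold.chart_mem_maximalAtlas _) hp p.2)

/-- The preferred chart of `TM` inverts `tangentCoordSymm`, so the components of the spray in it are
`(w, -Γ(w)w)`, visibly smooth. -/
theorem mfderiv_extChartAt_geodesicSpray {v₀ v : TangentBundle (𝓡 n) M}
    (hv : v.1 ∈ (chartAt (Rn n) v₀.1).source) :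
    mfderiv (𝓡 n).tangent 𝓘(ℝ, Rn n × Rn n) (extChartAt (𝓡 n).tangent v₀) v
      (C.geodesicSpray v) =
    ((extChartAt (𝓡 n).tangent v₀ v).2,
      -C.localForm (chartAt (Rn n) v₀.1) (extChartAt (𝓡 n).tangent v₀ v).1
        (extChartAt (𝓡 n).tangent v₀ v).2 (extChartAt (𝓡 n).tangent v₀ v).2) := by
  have hφ : chartAt (Rn n) v₀.1 ∈ IsManifold.maximalAtlas (𝓡 n) ∞ M :=
    IsManifold.chart_mem_maximalAtlas _
  rw [C.geodesicSpray_eq hφ hv, extChartAt_tangentBundle_apply hv]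
  have hT := tangentCoordSymm_fibreCoord hφ hv
  have h1 : MDifferentiableAt (𝓡 n).tangent 𝓘(ℝ, Rn n × Rn n) (extChartAt (𝓡 n).tangent v₀) v :=
    mdifferentiableAt_extChartAt ((TangentBundle.mem_chart_source_iff _ _).2 hv)
  have hy := (chartAt (Rn n) v₀.1).map_source hv
  -- Freeing the coordinates from `v` allows `v` itself to be replaced by `tangentCoordSymm` of `(y,
  -- w)`, so that the chain rule applies at `(y, w)`.
  generalize fibreCoord (chartAt (Rn n) v₀.1) v.2 = w at hT ⊢
  generalize (chartAt (Rn n) v₀.1) v.1 = y at hT hy ⊢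
  generalize -C.localForm (chartAt (Rn n) v₀.1) y w w = r
  subst hT
  have h2 : MDifferentiableAt 𝓘(ℝ, Rn n × Rn n) (𝓡 n).tangent
      (tangentCoordSymm (chartAt (Rn n) v₀.1) : _ → TangentBundle (𝓡 n) M) (y, w) :=
    (contMDiffAt_tangentCoordSymm hφ hy).mdifferentiableAt (by simp)
  have h3 := congrArg (fun L => L (w, r)) (mfderiv_comp (I' := (𝓡 n).tangent) (y, w) h1 h2)
  refine h3.symm.trans ?_
  have h4 : HasMFDerivAt 𝓘(ℝ, Rn n × Rn n) 𝓘(ℝ, Rn n × Rn n)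
      (extChartAt (𝓡 n).tangent v₀ ∘ tangentCoordSymm (chartAt (Rn n) v₀.1)) (y, w)
      (ContinuousLinearMap.id ℝ (Rn n × Rn n)) := by
    refine (hasMFDerivAt_id _).congr_of_eventuallyEq ?_
    filter_upwards [continuous_fst.continuousAt.preimage_mem_nhds
      ((chartAt (Rn n) v₀.1).open_target.mem_nhds hy)] with q hq
    exact extChartAt_tangentCoordSymm v₀ hq
  exact congrArg (fun L => L (w, r)) h4.mfderiv

theorem contMDiff_geodesicSpray : ContMDiff (𝓡 n).tangent (𝓡 n).tangent.tangent ∞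
    (fun v => (⟨v, C.geodesicSpray v⟩ :
      TangentBundle (𝓡 n).tangent (TangentBundle (𝓡 n) M))) := by
  intro v₀
  rw [contMDiffAt_section]
  have hφ : chartAt (Rn n) v₀.1 ∈ IsManifold.maximalAtlas (𝓡 n) ∞ M :=
    IsManifold.chart_mem_maximalAtlas _
  have h0 : ContMDiffAt (𝓡 n).tangent 𝓘(ℝ, Rn n × Rn n) ∞ (extChartAt (𝓡 n).tangent v₀) v₀ :=
    contMDiffAt_extChartAt
  have hp : (extChartAt (𝓡 n).tangent v₀ v₀).1 ∈ (chartAt (Rn n) v₀.1).target := by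
    rw [extChartAt_tangentBundle_apply (mem_chart_source _ _)]
    exact mem_chart_target _ _
  have hsnd : ContMDiffAt 𝓘(ℝ, Rn n × Rn n) 𝓘(ℝ, Rn n) ∞ (Prod.snd : Rn n × Rn n → Rn n)
      (extChartAt (𝓡 n).tangent v₀ v₀) := contDiffAt_snd.contMDiffAt
  have h1 := (hsnd.prodMk_space ((C.contMDiffAt_localForm hφ hp).clm_apply hsnd).neg).comp v₀ h0
  refine h1.congr_of_eventuallyEq ?_
  filter_upwards [(FiberBundle.continuous_proj (Rn n) (TangentSpace (𝓡 n) : M → Type)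
    ).continuousAt.preimage_mem_nhds
      ((chartAt (Rn n) v₀.1).open_source.mem_nhds (mem_chart_source _ _))] with v hv
  have hv' : v ∈ (chartAt (ModelProd (Rn n) (Rn n)) v₀).source :=
    (TangentBundle.mem_chart_source_iff _ _).2 hv
  -- The trivialization of `T(TM)` at `v₀` is the derivative of the chart of `TM` there.
  rw [← Trivialization.continuousLinearMapAt_apply_of_mem ℝ _ hv',
    TangentBundle.continuousLinearMapAt_trivializationAt hv']
  exact C.mfderiv_extChartAt_geodesicSpray hv

theorem isSecondOrderVectorField_geodesicSpray : IsSecondOrderVectorField C.geodesicSpray :=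
  ⟨C.contMDiff_geodesicSpray, C.mfderiv_proj_geodesicSpray⟩

end LinearConnection

theorem mainTheorem3 {n : ℕ} {M : Type*} [TopologicalSpace M] [ChartedSpace (Rn n) M]
    [IsManifold (𝓡 n) ∞ M] (C : LinearConnection n M) :
    (∀ (ξ : Rn n) (u : FrameBundle n M), ∃! X, C.IsStandardHorizontal ξ u X) ∧
    (∃! Z : Π v : TangentBundle (𝓡 n) M, TangentSpace (𝓡 n).tangent v, C.IsGeodesicSpray Z) ∧
    (∃ cov : CovariantDerivative (𝓡 n) (Rn n) (TangentSpace (𝓡 n) : M → Type),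
      C.Corresponds cov) ∧
    ∀ Z : Π v : TangentBundle (𝓡 n) M, TangentSpace (𝓡 n).tangent v, C.IsGeodesicSpray Z →
      IsSecondOrderVectorField Z ∧
      ∀ cov : CovariantDerivative (𝓡 n) (Rn n) (TangentSpace (𝓡 n) : M → Type),
        C.Corresponds cov →
        ∀ φ ∈ IsManifold.maximalAtlas (𝓡 n) ∞ M,
          ∀ v : TangentBundle (𝓡 n) M, v.1 ∈ φ.source →
            Z v = ∑ i, fibreCoord φ v.2 i • tangentCoordFieldX φ i v
              - ∑ i, (∑ j, ∑ k, christoffel cov φ i j k v.1 *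
                  fibreCoord φ v.2 j * fibreCoord φ v.2 k) • tangentCoordFieldV φ i v := by
  refine ⟨C.existsUnique_isStandardHorizontal,
    ⟨C.geodesicSpray, C.isGeodesicSpray_geodesicSpray, fun Z hZ => hZ.eq⟩,
    ⟨C.affineConnection, C.corresponds_affineConnection⟩, ?_⟩
  rintro Z hZ
  obtain rfl := LinearConnection.IsGeodesicSpray.eq hZ
  exact ⟨C.isSecondOrderVectorField_geodesicSpray,
    fun cov hcov φ hφ v hv => C.geodesicSpray_eq_sum hcov hφ hv⟩
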